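/- **Symbolic games.** A symbolic game structure $\mathcal G=\langle \mathcal V,\mathcal X,\mathcal Y,\theta_\exists,\rho_\exists,\varphi\rangle$ consists of a finite set $\mathcal V$ of Boolean variables, input variables $\mathcal X\subseteq\mathcal V$, output variables $\mathcal Y=\mathcal V\setminus\mathcal X$, an initial assertion $\theta_\exists$ over $\mathcal V$, a transition assertion $\rho_\exists$ over unprimed and primed copies of $\mathcal V$, and an LTL winning condition $\varphi$ over $\mathcal V$. Let $\Sigma,\Sigma_{\mathcal X},\Sigma_{\mathcal Y}$ be the sets of valuations of $\mathcal V,\mathcal X,\mathcal Y$. From a node $s\in\Sigma$ the universal player picks $s_{\mathcal X}\in\Sigma_{\mathcal X}$; then, at $(s,s_{\mathcal X})$, the existential player picks $s_{\mathcal Y}\in\Sigma_{\mathcal Y}$ with $(s,(s_{\mathcal X},s_{\mathcal Y}))\models\rho_\exists$, and the play continues from $(s_{\mathcal X},s_{\mathcal Y})\in\Sigma$. The existential player wins a play if it is infinite and its sequence of nodes of $\Sigma$ satisfies $\varphi$ (so she loses if she cannot move). $W_\exists\subseteq\Sigma$ is the set of nodes from which she has a (history-dependent) winning strategy. **Winning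 condition and colors.** Assume that $\varphi$ is (equivalent to) an Emerson-Lei formula, that is, a finite Boolean combination of atoms $\mathsf{Inf}\,\psi:=GF\psi$ with $\psi$ a Boolean formula over $\mathcal V$; $\mathsf{Fin}\,\psi$ abbreviates $\neg\mathsf{Inf}\,\psi$. Let the set of colors $C$ consist of all Boolean formulas over $\mathcal V$ that are subformulas of this Emerson-Lei formula, and color $s\in\Sigma$ by $\gamma(s)=\{\psi\in C\mid s\models\psi\}$. For $D\subseteq C$, $D\models\varphi$ is defined inductively from $D\models\mathsf{Inf}\,\psi\Leftrightarrow\psi\in D$. **Zielonka tree.** $\mathcal Z_\varphi=(T,R,l)$ is the tree whose root $r$ has label $l(r)=C$ and in which each vertex $t$ has exactly one child labeled $D$ for each $D$ that is maximal in $\{D'\subsetneq l(t)\mid D'\models\varphi\Leftrightarrow l(t)\not\models\varphi\}$. $R(t)$ is the set of children of $t$, and $s\le t$ means that $s$ is an ancestor of $t$ or $s=t$. A vertex $t$ is winning if $l(t)\models\varphi$, and losing otherwise. Fix any total order on $T$ that extends $\le$ (the root comes first), and number the vertices accordingly. For $s<t$ put $\mathsf{anc}^s_t=\{v\in\Sigma\mid\gamma(v)\subseteq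 l(s),\ \gamma(v)\not\subseteq l(s_t)\}$, where $s_t$ is the child of $s$ with $s_t\le t$, and put $\mathsf{anc}^t_t=\{v\in\Sigma\mid\gamma(v)\subseteq l(t)\}$. **Equation system.** For $S\subseteq\Sigma$ let $$\mathsf{CPre}(S)=\{v\in\Sigma\mid\forall s_{\mathcal X}\in\Sigma_{\mathcal X}\,\exists s_{\mathcal Y}\in\Sigma_{\mathcal Y}.\ (s_{\mathcal X},s_{\mathcal Y})\in S\text{ and }(v,(s_{\mathcal X},s_{\mathcal Y}))\models\rho_\exists\}.$$ The system $S_\varphi$ has, for each $s\in T$, the equation $$X_s=_{\eta_s}\begin{cases}\bigcup_{t\in R(s)}X_t & R(s)\neq\emptyset,\ s\text{ losing}\\ \bigcap_{t\in R(s)}X_t & R(s)\neq\emptyset,\ s\text{ winning}\\ \bigcup_{s'\le s}\bigl(\mathsf{anc}^{s'}_s\cap\mathsf{CPre}(X_{s'})\bigr) & R(s)=\emptyset,\end{cases}$$ with $\eta_s=\mathsf{GFP}$ if $s$ is winning and $\eta_s=\mathsf{LFP}$ if $s$ is losing. The solution $[\![X_i]\!]$ of a system $X_i=_{\eta_i}f_i(X_1,\dots,X_k)$,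 $1\le i\le k$, of monotone equations over $\mathcal P(\Sigma)$ is the set of $v\in\Sigma$ such that the existential player wins from $(v,i)$ in the following fixpoint game. From $(v,i)$ she moves to some $(A_1,\dots,A_k)\in\mathcal P(\Sigma)^k$ with $v\in f_i(A_1,\dots,A_k)$; from $(A_1,\dots,A_k)$ the universal player moves to some $(w,j)$ with $w\in A_j$; a player who cannot move loses; and an infinite play is won by the existential player if and only if the equation of minimal index among those visited infinitely often is a $\mathsf{GFP}$ equation. **Lemma.** The winning region is the solution of the root variable: $W_\exists=[\![X_r]\!]$. -/

import Mathlib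

/-! ### Boolean formulas and LTL -/

/-- `BForm α`: finite Boolean formulas over atoms from `α`, i.e. `𝔹(α)`. -/
inductive BForm (α : Type*) : Type _
  | tt : BForm α
  | ff : BForm α
  | atom : α → BForm α
  | neg : BForm α → BForm α
  | conj : BForm α → BForm α → BForm α
  | disj : BForm α → BForm α → BForm α

/-- Truth of a Boolean formula when `P` is the set of true atoms. -/
def BForm.Sat {α : Type*} (P : Set α) : BForm α → Prop
  | .tt => True
  | .ff => False
  | .atom a => a ∈ P
  | .neg φ => ¬ φ.Sat P
  | .conj φ ψ => φ.Sat P ∧ ψ.Sat P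
  | .disj φ ψ => φ.Sat P ∨ ψ.Sat P

/-- Syntax of linear temporal logic over the atomic propositions `AP`. -/
inductive LTL (AP : Type*) : Type _
  | tt : LTL AP
  | ff : LTL AP
  | atom : AP → LTL AP
  | neg : LTL AP → LTL AP
  | conj : LTL AP → LTL AP → LTL AP
  | disj : LTL AP → LTL AP → LTL AP
  | next : LTL AP → LTL AP
  | until : LTL AP → LTL AP → LTL AP
  | finally : LTL AP → LTL AP
  | globally : LTL AP → LTL AP

/-- `φ.Sat w i`: the infinite word `w` of valuations satisfies `φ` at position `i`. -/
def LTL.Sat {AP : Type*} (w : ℕ → AP → Bool) : LTL AP → ℕ → Prop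
  | .tt, _ => True
  | .ff, _ => False
  | .atom p, i => w i p = true
  | .neg φ, i => ¬ LTL.Sat w φ i
  | .conj φ ψ, i => LTL.Sat w φ i ∧ LTL.Sat w ψ i
  | .disj φ ψ, i => LTL.Sat w φ i ∨ LTL.Sat w ψ i
  | .next φ, i => LTL.Sat w φ (i + 1)
  | .until φ ψ, i => ∃ j, i ≤ j ∧ LTL.Sat w ψ j ∧ ∀ l, i ≤ l → l < j → LTL.Sat w φ l
  | .finally φ, i => ∃ j, i ≤ j ∧ LTL.Sat w φ j
  | .globally φ, i => ∀ j, i ≤ j → LTL.Sat w φ j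

/-- The set of subformulas of an LTL formula (including the formula itself). -/
def LTL.subformulas {AP : Type*} : LTL AP → Set (LTL AP)
  | .tt => {.tt}
  | .ff => {.ff}
  | .atom p => {.atom p}
  | .neg φ => insert (.neg φ) φ.subformulas
  | .conj φ ψ => insert (.conj φ ψ) (φ.subformulas ∪ ψ.subformulas)
  | .disj φ ψ => insert (.disj φ ψ) (φ.subformulas ∪ ψ.subformulas)
  | .next φ => insert (.next φ) φ.subformulas
  | .until φ ψ => insert (.until φ ψ) (φ.subformulas ∪ ψ.subformulas)
  | .finally φ => insert (.finally φ) φ.subformulas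
  | .globally φ => insert (.globally φ) φ.subformulas

/-- A Boolean formula read as an LTL formula. -/
def BForm.toLTL {AP : Type*} : BForm AP → LTL AP
  | .tt => .tt
  | .ff => .ff
  | .atom p => .atom p
  | .neg φ => .neg φ.toLTL
  | .conj φ ψ => .conj φ.toLTL ψ.toLTL
  | .disj φ ψ => .disj φ.toLTL ψ.toLTL

/-- Emerson-Lei formulas over the colors `Col`: Boolean formulas whose atom `c` stands for `Inf c`;
`Fin c` abbreviates `¬ Inf c`. A set `D` of colors satisfies `φ` if `φ.Sat D`. -/
abbrev ELFormula (Col : Type*) : Type _ := BForm Col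

/-- An Emerson-Lei formula whose colors are Boolean formulas, as an LTL formula, where
`Inf ψ` is `G F ψ`. -/
def elToLTL {AP : Type*} : ELFormula (BForm AP) → LTL AP
  | .tt => .tt
  | .ff => .ff
  | .atom ψ => .globally (.finally ψ.toLTL)
  | .neg φ => .neg (elToLTL φ)
  | .conj φ₁ φ₂ => .conj (elToLTL φ₁) (elToLTL φ₂)
  | .disj φ₁ φ₂ => .disj (elToLTL φ₁) (elToLTL φ₂)

/-- The colors of `φ`: all Boolean formulas that are subformulas of `φ`. -/
def boolSubformulas {AP : Type*} (φ : ELFormula (BForm AP)) : Set (BForm AP) :=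
  {ψ | ψ.toLTL ∈ (elToLTL φ).subformulas}

/-! ### Games -/

/-- A game arena on the nodes `N`; the nodes outside `exist` belong to the universal player. -/
structure Arena (N : Type*) where
  exist : Set N
  move : N → N → Prop

namespace Arena

variable {N : Type*}

/-- The finite sequence `π 0, …, π i`. -/
def history (π : ℕ → N) (i : ℕ) : List N := (List.range (i + 1)).map π

/-- The step of `π` from position `i` to `i + 1` is a move and, at an existential node, the one
chosen by the strategy `σ`. -/
def CompliantStep (A : Arena N) (σ : List N → N) (π : ℕ → N) (i : ℕ) : Prop :=
  A.move (π i) (π (i + 1)) ∧ (π i ∈ A.exist → π (i + 1) = σ (history π i))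

/-- `σ` (read on nonempty histories that end in an existential node) is winning for the existential
player from `v`: after every finite compliant play that ends in an existential node, `σ` gives
a legal move, and all infinite compliant plays are in the objective `α`.
So a player who is to move and cannot loses. -/
def WinningFrom (A : Arena N) (α : Set (ℕ → N)) (σ : List N → N) (v : N) : Prop :=
  (∀ (π : ℕ → N) (n : ℕ), π 0 = v → (∀ i < n, A.CompliantStep σ π i) → π n ∈ A.exist →
      A.move (π n) (σ (history π n))) ∧
  (∀ π : ℕ → N, π 0 = v → (∀ i, A.CompliantStep σ π i) → π ∈ α)

/-- The set of nodes that are winning for the existential player. -/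
def winningRegion (A : Arena N) (α : Set (ℕ → N)) : Set N :=
  {v | ∃ σ : List N → N, A.WinningFrom α σ v}

end Arena

/-! ### Hierarchical systems of fixpoint equations -/

inductive FixKind : Type
  | lfp
  | gfp

/-- A system of `k` equations `X i =_{kind i} rhs i (X 0, …, X (k-1))` over the subsets of `N`,
with monotone right-hand sides. -/
structure FixSystem (N : Type*) (k : ℕ) where
  kind : Fin k → FixKind
  rhs : Fin k → (Fin k → Set N) → Set N
  mono : ∀ i, Monotone (rhs i)

namespace FixSystem

variable {N : Type*} {k : ℕ}

/-- The arena of the fixpoint game: from `(v, i)` the existential player moves to a tuple `A` with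
`v ∈ rhs i A`, and from `A` the universal player moves to some `(v, i)` with `v ∈ A i`. -/
def arena (S : FixSystem N k) : Arena ((N × Fin k) ⊕ (Fin k → Set N)) where
  exist := Set.range Sum.inl
  move
    | .inl (v, i), .inr A => v ∈ S.rhs i A
    | .inr A, .inl (v, i) => v ∈ A i
    | _, _ => False

/-- Equation `i` is evaluated infinitely often in `π`. -/
def InfOften (π : ℕ → (N × Fin k) ⊕ (Fin k → Set N)) (i : Fin k) : Prop :=
  ∀ n, ∃ m, n ≤ m ∧ ∃ v, π m = .inl (v, i)

/-- The equation of minimal index among those that are evaluated infinitely often is a greatest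
fixpoint equation. -/
def objective (S : FixSystem N k) : Set (ℕ → (N × Fin k) ⊕ (Fin k → Set N)) :=
  {π | ∃ i, InfOften π i ∧ (∀ j, InfOften π j → i ≤ j) ∧ S.kind i = .gfp}

/-- The solution of the variable `X i`. -/
def solution (S : FixSystem N k) (i : Fin k) : Set N :=
  {v | .inl (v, i) ∈ S.arena.winningRegion S.objective}

end FixSystem

/-! ### Zielonka trees -/

section Zielonka

variable {Col : Type*}

/-- `D` labels a child of a vertex labeled `L`: it is maximal among the proper subsets of `L` whose
satisfaction of `φ` differs from that of `L`. -/
def IsChildLabel (φ : ELFormula Col) (L D : Set Col) : Prop :=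
  Maximal (fun D' => D' ⊂ L ∧ (φ.Sat D' ↔ ¬ φ.Sat L)) D

/-- The vertices of the Zielonka tree, each given as the list of the labels on the way from
the vertex (head of the list) up to the root (last entry, `C`). -/
inductive IsZVertex (φ : ELFormula Col) (C : Set Col) : List (Set Col) → Prop
  | root : IsZVertex φ C [C]
  | child {p : List (Set Col)} {D : Set Col} :
      IsZVertex φ C p → IsChildLabel φ (p.headD ∅) D → IsZVertex φ C (D :: p)

/-- The vertex set `T` of the Zielonka tree of `φ` over the colors `C`. -/
def ZVertex (φ : ELFormula Col) (C : Set Col) : Type _ := {p : List (Set Col) // IsZVertex φ C p}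

namespace ZVertex

variable {φ : ELFormula Col} {C : Set Col}

/-- The root. -/
def root (φ : ELFormula Col) (C : Set Col) : ZVertex φ C := ⟨[C], .root⟩

/-- The label `l(t)`. -/
def label (t : ZVertex φ C) : Set Col := t.1.headD ∅

/-- `s.Anc t`: `s` is an ancestor of `t` or `t` itself, `s ≤ t`. -/
def Anc (s t : ZVertex φ C) : Prop := s.1 <:+ t.1

/-- The set `R(s)` of child vertices of `s`. -/
def children (s : ZVertex φ C) : Set (ZVertex φ C) := {t | ∃ D, t.1 = D :: s.1}

/-- Winning vertices of the tree; the others are losing. -/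
def Winning (t : ZVertex φ C) : Prop := φ.Sat t.label

/-- The set `anc^s_t` for `s ≤ t`: the nodes `v` with `γ v ⊆ l(s)` and `γ v ⊄ l(s_t)`, where `s_t`
is the child of `s` that leads to `t`. If `s = t` there is no such child, and only the first
condition remains. -/
def anchor {N : Type*} (γ : N → Set Col) (s t : ZVertex φ C) : Set N :=
  {v | γ v ⊆ s.label ∧ ∀ u ∈ s.children, u.Anc t → ¬ γ v ⊆ u.label}

open Classical in
/-- The right-hand side of the equation for `X_s`. -/
noncomputable def rhs {N : Type*} (γ : N → Set Col) (cpre : Set N →o Set N) (s : ZVertex φ C)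
    (X : ZVertex φ C → Set N) : Set N :=
  if s.children = ∅ then ⋃ s' ∈ {s' : ZVertex φ C | s'.Anc s}, anchor γ s' s ∩ cpre (X s')
  else if s.Winning then ⋂ t ∈ s.children, X t
  else ⋃ t ∈ s.children, X t

open Classical in
/-- The fixpoint kind of the equation for `X_s`. -/
noncomputable def kind (s : ZVertex φ C) : FixKind := if s.Winning then .gfp else .lfp

theorem rhs_mono {N : Type*} (γ : N → Set Col) (cpre : Set N →o Set N) (s : ZVertex φ C) :
    Monotone (rhs γ cpre s) := by
  intro X Y h
  unfold rhs
  split_ifs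
  · exact Set.iUnion₂_mono fun s' _ => Set.inter_subset_inter_right _ (cpre.monotone (h s'))
  · exact Set.iInter₂_mono fun t _ => h t
  · exact Set.iUnion₂_mono fun t _ => h t

end ZVertex

/-- The Emerson-Lei equation system, for a numbering `e` of the vertices of the Zielonka tree, a
coloring `γ` of the nodes and a controllable predecessor function `cpre`. -/
noncomputable def elSystem {N : Type*} {k : ℕ} {φ : ELFormula Col} {C : Set Col}
    (e : ZVertex φ C ≃ Fin k) (γ : N → Set Col) (cpre : Set N →o Set N) : FixSystem N k where
  kind i := (e.symm i).kind
  rhs i A := (e.symm i).rhs γ cpre (fun t => A (e t))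
  mono i _ _ h := ZVertex.rhs_mono γ cpre (e.symm i) fun t => h (e t)

end Zielonka

/-! ### Symbolic game structures -/

/-- A symbolic game structure over the Boolean variables `Var`, with input variables `inputs`.
The transition relation is an assertion over unprimed (`Sum.inl`) and primed (`Sum.inr`) copies
of the variables. -/
structure SymbolicGame (Var : Type*) where
  inputs : Set Var
  init : BForm Var
  trans : BForm (Var ⊕ Var)
  win : LTL Var

namespace SymbolicGame

variable {Var : Type*}

/-- The output variables. -/
def outputs (G : SymbolicGame Var) : Set Var := G.inputsᶜ

/-- The valuations of the input variables. -/
abbrev In (G : SymbolicGame Var) : Type _ := G.inputs → Bool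

/-- The valuations of the output variables. -/
abbrev Out (G : SymbolicGame Var) : Type _ := G.outputs → Bool

open Classical in
/-- The node given by an input and an output valuation. -/
noncomputable def join (G : SymbolicGame Var) (x : G.In) (y : G.Out) : Var → Bool :=
  fun v => if h : v ∈ G.inputs then x ⟨v, h⟩ else y ⟨v, h⟩

/-- A node (valuation) satisfies an assertion. -/
def NodeSat (s : Var → Bool) (ψ : BForm Var) : Prop := ψ.Sat {v | s v = true}

/-- `(s, s') ⊨ ρ`. -/
def Trans (G : SymbolicGame Var) (s s' : Var → Bool) : Prop :=
  G.trans.Sat {v | Sum.elim s s' v = true}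

/-- The arena of `G`: the universal player moves from a node `s` to `(s, x)` for an input `x`,
then the existential player moves to `(x, y)` for a possible output `y`. -/
def arena (G : SymbolicGame Var) : Arena ((Var → Bool) ⊕ ((Var → Bool) × G.In)) where
  exist := Set.range Sum.inr
  move
    | .inl s, .inr (s', _) => s' = s
    | .inr (s, x), .inl s' => ∃ y : G.Out, s' = G.join x y ∧ G.Trans s s'
    | _, _ => False

/-- Plays that start in a universal node and whose sequence of universal nodes satisfies the winning
condition; the intermediate existential nodes are ignored. -/
def objective (G : SymbolicGame Var) : Set (ℕ → (Var → Bool) ⊕ ((Var → Bool) × G.In)) :=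
  {π | ∃ w : ℕ → Var → Bool, (∀ n, π (2 * n) = .inl (w n)) ∧ G.win.Sat w 0}

/-- The set of nodes (valuations of all variables) that are winning for the existential player. -/
def winningRegion (G : SymbolicGame Var) : Set (Var → Bool) :=
  {s | .inl s ∈ G.arena.winningRegion G.objective}

/-- The symbolic controllable predecessor: for each input there is an output such that the resulting
node is in `S` and is a successor. -/
def cpre (G : SymbolicGame Var) : Set (Var → Bool) →o Set (Var → Bool) where
  toFun S := {s | ∀ x : G.In, ∃ y : G.Out, G.join x y ∈ S ∧ G.Trans s (G.join x y)}
  monotone' _ _ h _ hs x := (hs x).imp fun _ hy => ⟨h hy.1, hy.2⟩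

end SymbolicGame

/-- The coloring of nodes by the formulas of `C` that they satisfy. -/
def coloring {Var : Type*} (C : Set (BForm Var)) (s : Var → Bool) : Set (BForm Var) :=
  {ψ ∈ C | SymbolicGame.NodeSat s ψ}

open Filter

/-! A play of the fixpoint game walks through the Zielonka tree. At an inner vertex it keeps the
node `v` and descends to a child, chosen by the universal player at winning vertices and by the
existential player at losing ones. At a leaf it moves to a successor of `v` in the symbolic game and
jumps up to the ancestor at which `v` is anchored. The nodes at the leaves thus form a play of the
symbolic game.

Let `r` be the vertex of minimal index visited infinitely often. Since the numbering extends the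
ancestor order, the walk finally stays below `r` (`exists_min`), so the set `D` of colors seen
infinitely often lies in `l(r)`. Suppose that every child `t` of `r` is entered from `r` infinitely
often. Each return from the subtree of `t` to `r` needs a color outside `l(t)`
(`exists_not_subset`), so `D` is contained in no label of a child. As the children carry the maximal
subsets of `l(r)` on which `φ` changes its value, `D` satisfies `φ` if and only if `r` is winning
(`sat_iff_winning`).

Each inclusion translates a strategy and lets one player rotate through the children. Given a
strategy in the fixpoint game, the simulated universal player rotates at winning vertices; the
parity condition makes `r` winning, so `φ` holds. Given a strategy in the symbolic game, the
existential player rotates at losing vertices; a losing `r` would contradict `φ`. Determinacy is not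
needed. Strategies are handled as nondeterministic relations on a memory set, in which both games
can be described round by round. -/

/-- Interleaving of two sequences. -/
def interleave {M : Type*} (a b : ℕ → M) (n : ℕ) : M := if n % 2 = 0 then a (n / 2) else b (n / 2)

theorem interleave_even {M : Type*} (a b : ℕ → M) (n : ℕ) : interleave a b (2 * n) = a n := by
  simp [interleave]

theorem interleave_odd {M : Type*} (a b : ℕ → M) (n : ℕ) : interleave a b (2 * n + 1) = b n := by
  have h1 : (2 * n + 1) % 2 = 1 := by omega
  have h2 : (2 * n + 1) / 2 = n := by omega
  simp [interleave, h1, h2]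

/-- Rebuilds a full play from its sequence of rounds, with `b` supplying the intermediate positions.
-/
theorem interleave_chain {M : Type*} {R : M → M → Prop} {a b : ℕ → M} (h1 : ∀ n, R (a n) (b n))
    (h2 : ∀ n, R (b n) (a (n + 1))) (n : ℕ) :
    R (interleave a b n) (interleave a b (n + 1)) := by
  rcases Nat.even_or_odd' n with ⟨m, rfl | rfl⟩
  · rw [interleave_even, interleave_odd]; exact h1 m
  · rw [interleave_odd, show 2 * m + 1 + 1 = 2 * (m + 1) by ring, interleave_even]; exact h2 m

/-! ### Strategies with memory -/

namespace Arena

universe u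

variable {N : Type u}

theorem history_succ (π : ℕ → N) (i : ℕ) : history π (i + 1) = history π i ++ [π (i + 1)] := by
  simp [history, List.range_succ (n := i + 1)]

theorem history_congr {π π' : ℕ → N} {i : ℕ} (h : ∀ j ≤ i, π j = π' j) :
    history π i = history π' i := by
  apply List.map_congr_left
  intro j hj
  exact h j (by simpa [Nat.lt_succ_iff] using hj)

theorem CompliantStep.congr {A : Arena N} {σ : List N → N} {π π' : ℕ → N} {i : ℕ}
    (h : ∀ j ≤ i + 1, π j = π' j) (hc : A.CompliantStep σ π i) : A.CompliantStep σ π' i := by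
  unfold CompliantStep at *
  rwa [← h i (by omega), ← h (i + 1) le_rfl, ← history_congr fun j hj => h j (by omega)]

/-- `R` is a nondeterministic winning strategy with memory `M` from `v`, where `pos m` is the current
node of the play. -/
def HasMemoryStrategy (A : Arena N) (α : Set (ℕ → N)) (v : N) : Prop :=
  ∃ (M : Type u) (pos : M → N) (R : M → M → Prop) (m₀ : M), pos m₀ = v ∧
    (∀ m, pos m ∈ A.exist → ∃ m', R m m' ∧ A.move (pos m) (pos m')) ∧
    (∀ m, pos m ∉ A.exist → ∀ w, A.move (pos m) w → ∃ m', R m m' ∧ pos m' = w) ∧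
    ∀ ms : ℕ → M, ms 0 = m₀ → (∀ n, R (ms n) (ms (n + 1))) → pos ∘ ms ∈ α

theorem hasMemoryStrategy_of_mem_winningRegion {A : Arena N} {α : Set (ℕ → N)} {v : N}
    (h : v ∈ A.winningRegion α) : A.HasMemoryStrategy α v := by
  obtain ⟨σ, hσ1, hσ2⟩ := h
  -- The memory is the finite compliant play so far: `(π, n)` stands for `π 0, …, π n`, and the
  -- later values of `π` are irrelevant.
  let M : Type u := {p : (ℕ → N) × ℕ // p.1 0 = v ∧ ∀ i < p.2, A.CompliantStep σ p.1 i}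
  have ext : ∀ (m : M) (w : N), A.move (m.1.1 m.1.2) w →
      (m.1.1 m.1.2 ∈ A.exist → w = σ (history m.1.1 m.1.2)) →
      ∃ m' : M, (m'.1.2 = m.1.2 + 1 ∧ ∀ i ≤ m.1.2, m'.1.1 i = m.1.1 i) ∧ m'.1.1 m'.1.2 = w := by
    rintro ⟨⟨π, n⟩, h0, hc⟩ w hw hσ
    have agree : ∀ i ≤ n, π i = Function.update π (n + 1) w i := fun i hi => by
      rw [Function.update_of_ne (by omega)]
    refine ⟨⟨⟨Function.update π (n + 1) w, n + 1⟩, ?_, ?_⟩, ⟨rfl, fun i hi => (agree i hi).symm⟩,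
      Function.update_self ..⟩
    · rw [← h0]; exact (agree 0 (Nat.zero_le _)).symm
    · intro i hi
      rcases Nat.lt_succ_iff_lt_or_eq.1 hi with hi | rfl
      · exact (hc i hi).congr fun j hj => agree j (by omega)
      · refine ⟨?_, ?_⟩
        · dsimp only; rw [← agree i le_rfl, Function.update_self]; exact hw
        · dsimp only
          rw [← agree i le_rfl, Function.update_self, ← history_congr agree]; exact hσ
  refine ⟨M, fun m => m.1.1 m.1.2,
    fun m m' => m'.1.2 = m.1.2 + 1 ∧ ∀ i ≤ m.1.2, m'.1.1 i = m.1.1 i,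
    ⟨⟨fun _ => v, 0⟩, rfl, fun i hi => absurd hi (Nat.not_lt_zero i)⟩, rfl, ?_, ?_, ?_⟩
  · intro m hm
    have hmv := hσ1 m.1.1 m.1.2 m.2.1 m.2.2 hm
    obtain ⟨m', h1, h2⟩ := ext m _ hmv fun _ => rfl
    exact ⟨m', h1, by dsimp only; rw [h2]; exact hmv⟩
  · intro m hm w hw
    exact ext m w hw fun h => absurd h hm
  · intro ms h0 hR
    have hlen : ∀ n, (ms n).1.2 = n := by
      intro n
      induction n with
      | zero => rw [h0]
      | succ n ih => rw [(hR n).1, ih]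
    have hagree : ∀ n i, i ≤ n → (ms n).1.1 i = (ms i).1.1 i := by
      intro n
      induction n with
      | zero => intro i hi; obtain rfl : i = 0 := by omega
                rfl
      | succ n ih =>
        intro i hi
        rcases Nat.le_succ_iff.1 hi with hi | rfl
        · rw [(hR n).2 i (by rw [hlen]; exact hi), ih i hi]
        · rfl
    have heq : ((fun m : M => m.1.1 m.1.2) ∘ ms) = fun n => (ms n).1.1 n := by
      funext n; simp [hlen]
    rw [heq]
    refine hσ2 _ (ms 0).2.1 fun i => ?_
    exact ((ms (i + 1)).2.2 i (by rw [hlen]; omega)).congr fun j hj => hagree _ _ hj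

/-- The memory is recomputed from the history. The state reconstructed after an existential move may
differ from the one used to choose that move, but it has the same position and is an `R`-successor.
This suffices because all `R`-paths from `m₀` are winning. -/
theorem mem_winningRegion_of_hasMemoryStrategy {A : Arena N} {α : Set (ℕ → N)} {v : N}
    (h : A.HasMemoryStrategy α v) : v ∈ A.winningRegion α := by
  classical
  obtain ⟨M, pos, R, m₀, h0, hE, hU, hα⟩ := h
  let c : M → M := fun m => if h : ∃ m', R m m' ∧ A.move (pos m) (pos m') then h.choose else m
  have hc : ∀ m, pos m ∈ A.exist → R m (c m) ∧ A.move (pos m) (pos (c m)) := by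
    intro m hm
    have := hE m hm
    simp only [c, dif_pos this]
    exact this.choose_spec
  let nx : M → N → M := fun m w => if h : ∃ m', R m m' ∧ pos m' = w then h.choose else m
  have hnx : ∀ m w, (∃ m', R m m' ∧ pos m' = w) → R m (nx m w) ∧ pos (nx m w) = w := by
    intro m w h
    simp only [nx, dif_pos h]
    exact h.choose_spec
  -- The head of the history is dropped because `m₀` already accounts for the initial node.
  let σ : List N → N := fun l => pos (c (l.tail.foldl nx m₀))
  let μ : (ℕ → N) → ℕ → M := fun π n => (history π n).tail.foldl nx m₀
  have hμ0 : ∀ π, μ π 0 = m₀ := fun π => by simp [μ, history]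
  have hμs : ∀ π n, μ π (n + 1) = nx (μ π n) (π (n + 1)) := by
    intro π n
    have hne : history π n ≠ [] := by simp [history]
    simp only [μ, history_succ, List.tail_append_of_ne_nil hne, List.foldl_append, List.foldl_cons,
      List.foldl_nil]
  have key : ∀ π : ℕ → N, ∀ n, pos (μ π n) = π n → A.CompliantStep σ π n →
      R (μ π n) (μ π (n + 1)) ∧ pos (μ π (n + 1)) = π (n + 1) := by
    intro π n hp hs
    rw [hμs]
    apply hnx
    by_cases hx : π n ∈ A.exist
    · exact ⟨c (μ π n), (hc _ (by rwa [hp])).1, (hs.2 hx).symm⟩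
    · exact hU _ (by rwa [hp]) _ (by rw [hp]; exact hs.1)
  have hpos : ∀ π : ℕ → N, π 0 = v → ∀ n, (∀ i < n, A.CompliantStep σ π i) →
      pos (μ π n) = π n := by
    intro π hπ n
    induction n with
    | zero => intro _; rw [hμ0, h0, hπ]
    | succ n ih => intro hs; exact (key π n (ih fun i hi => hs i (by omega)) (hs n (by omega))).2
  refine ⟨σ, ?_, ?_⟩
  · intro π n hπ hs hx
    have hp := hpos π hπ n hs
    rw [← hp] at hx ⊢
    exact (hc _ hx).2
  · intro π hπ hs
    have hp : pos ∘ μ π = π := funext fun n => hpos π hπ n fun i _ => hs i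
    rw [← hp]
    exact hα _ (hμ0 π) fun n => (key π n (hpos π hπ n fun i _ => hs i) (hs n)).1

theorem mem_winningRegion_iff {A : Arena N} {α : Set (ℕ → N)} {v : N} :
    v ∈ A.winningRegion α ↔ A.HasMemoryStrategy α v :=
  ⟨hasMemoryStrategy_of_mem_winningRegion, mem_winningRegion_of_hasMemoryStrategy⟩

end Arena

/-! ### The symbolic game in rounds -/

namespace SymbolicGame

universe u

variable {Var : Type u}

/-- Winning in a symbolic game, described round by round. -/
theorem mem_winningRegion_iff (G : SymbolicGame Var) (v : Var → Bool) :
    v ∈ G.winningRegion ↔ ∃ (M : Type u) (pos : M → Var → Bool) (R : M → M → Prop) (m₀ : M),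
      pos m₀ = v ∧
      (∀ m (x : G.In), ∃ m' y, R m m' ∧ pos m' = G.join x y ∧ G.Trans (pos m) (pos m')) ∧
      ∀ ms : ℕ → M, ms 0 = m₀ → (∀ n, R (ms n) (ms (n + 1))) → G.win.Sat (pos ∘ ms) 0 := by
  unfold winningRegion
  rw [Set.mem_ofPred_eq, Arena.mem_winningRegion_iff]
  constructor
  · rintro ⟨M, pos, R, m₀, h0, hE, hU, hα⟩
    refine ⟨{p : M × (Var → Bool) // pos p.1 = .inl p.2}, fun p => p.1.2,
      fun p p' => ∃ m, R p.1.1 m ∧ R m p'.1.1, ⟨(m₀, v), h0⟩, rfl, ?_, ?_⟩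
    · rintro ⟨⟨m, s⟩, hm⟩ x
      obtain ⟨m₁, h1, h2⟩ := hU m (by rw [hm]; rintro ⟨_, ⟨⟩⟩) (.inr (s, x)) (by rw [hm]; rfl)
      obtain ⟨m₂, h3, h4⟩ := hE m₁ (by rw [h2]; exact ⟨_, rfl⟩)
      rw [h2] at h4
      rcases h5 : pos m₂ with s' | p
      · rw [h5] at h4
        obtain ⟨y, hy, ht⟩ := h4
        exact ⟨⟨(m₂, s'), h5⟩, y, ⟨m₁, h1, h3⟩, hy, ht⟩
      · rw [h5] at h4; exact h4.elim
    · intro ms hms hR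
      choose b hb1 hb2 using hR
      obtain ⟨w, hw, hs⟩ := hα (interleave (fun n => (ms n).1.1) b)
        (by rw [show 0 = 2 * 0 by rfl, interleave_even]; simp [hms]) (interleave_chain hb1 hb2)
      convert hs using 1
      funext n
      have := hw n
      rw [Function.comp_apply, interleave_even, (ms n).2] at this
      exact Sum.inl_injective this
  · rintro ⟨M, pos, R, m₀, h0, hm, hα⟩
    let R' : M ⊕ (M × G.In) → M ⊕ (M × G.In) → Prop
      | .inl m, .inr p => p.1 = m
      | .inr p, .inl m' => R p.1 m' ∧ ∃ y, pos m' = G.join p.2 y ∧ G.Trans (pos p.1) (pos m')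
      | _, _ => False
    refine ⟨M ⊕ (M × G.In), Sum.elim (fun m => .inl (pos m)) (fun p => .inr (pos p.1, p.2)), R',
      .inl m₀, by simp [h0], ?_, ?_, ?_⟩
    · rintro (m | ⟨m, x⟩) hx
      · obtain ⟨_, ⟨⟩⟩ := hx
      · obtain ⟨m', y, h1, h2, h3⟩ := hm m x
        exact ⟨.inl m', ⟨h1, y, h2, h3⟩, y, h2, h3⟩
    · rintro (m | ⟨m, x⟩) hx w hw
      · rcases w with w | ⟨s, x⟩
        · exact hw.elim
        · obtain rfl : s = pos m := hw
          exact ⟨.inr (m, x), rfl, rfl⟩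
      · exact (hx ⟨_, rfl⟩).elim
    · intro ms hms hR
      have step : ∀ n m, ms n = .inl m → ∃ m', ms (n + 2) = .inl m' ∧ R m m' := by
        intro n m hn
        have h1 := hR n
        have h2 := hR (n + 1)
        rw [hn] at h1
        rcases h3 : ms (n + 1) with m₁ | p
        · rw [h3] at h1; exact h1.elim
        · rw [h3] at h1 h2
          obtain rfl : p.1 = m := h1
          rcases h4 : ms (n + 1 + 1) with m₂ | p
          · rw [h4] at h2; exact ⟨m₂, rfl, h2.1⟩
          · rw [h4] at h2; exact h2.elim
      have hev : ∀ n, ∃ m, ms (2 * n) = .inl m := by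
        intro n
        induction n with
        | zero => exact ⟨m₀, hms⟩
        | succ n ih =>
          obtain ⟨m, hm⟩ := ih
          obtain ⟨m', h, -⟩ := step _ _ hm
          exact ⟨m', h⟩
      choose a ha using hev
      refine ⟨pos ∘ a, fun n => by simp [ha], hα a ?_ fun n => ?_⟩
      · exact Sum.inl_injective ((ha 0).symm.trans hms)
      · obtain ⟨m', h, hr⟩ := step _ _ (ha n)
        rwa [Sum.inl_injective ((ha (n + 1)).symm.trans h)]

end SymbolicGame

/-! ### The fixpoint game in rounds -/

namespace FixSystem

universe u

variable {N : Type u} {k : ℕ}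

/-- The minimal index occurring infinitely often in `c` is that of a greatest fixpoint equation. -/
def ParityWin (S : FixSystem N k) (c : ℕ → Fin k) : Prop :=
  ∃ i, (∃ᶠ n in atTop, c n = i) ∧ (∀ j, (∃ᶠ n in atTop, c n = j) → i ≤ j) ∧ S.kind i = .gfp

theorem infOften_iff {π : ℕ → (N × Fin k) ⊕ (Fin k → Set N)} {a : ℕ → N × Fin k}
    (h1 : ∀ n, π (2 * n) = .inl (a n)) (h2 : ∀ n p, π (2 * n + 1) ≠ .inl p) (i : Fin k) :
    InfOften π i ↔ ∃ᶠ n in atTop, (a n).2 = i := by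
  rw [frequently_atTop]
  constructor
  · intro h n
    obtain ⟨m, hm, v, hv⟩ := h (2 * n)
    rcases Nat.even_or_odd' m with ⟨l, rfl | rfl⟩
    · refine ⟨l, by omega, ?_⟩
      rw [h1] at hv
      rw [Sum.inl_injective hv]
    · exact (h2 _ _ hv).elim
  · intro h n
    obtain ⟨m, hm, rfl⟩ := h n
    exact ⟨2 * m, by omega, (a m).1, h1 m⟩

theorem mem_objective_iff (S : FixSystem N k) {π : ℕ → (N × Fin k) ⊕ (Fin k → Set N)}
    {a : ℕ → N × Fin k} (h1 : ∀ n, π (2 * n) = .inl (a n)) (h2 : ∀ n p, π (2 * n + 1) ≠ .inl p) :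
    π ∈ S.objective ↔ S.ParityWin fun n => (a n).2 := by
  simp only [objective, Set.mem_ofPred_eq, ParityWin, infOften_iff h1 h2]

/-- Winning in a fixpoint game, described round by round. -/
theorem mem_solution_iff (S : FixSystem N k) (v : N) (i : Fin k) :
    v ∈ S.solution i ↔ ∃ (M : Type u) (pos : M → N × Fin k) (R : M → M → Prop) (m₀ : M),
      pos m₀ = (v, i) ∧
      (∀ m, ∃ A : Fin k → Set N, (pos m).1 ∈ S.rhs (pos m).2 A ∧
        ∀ w j, w ∈ A j → ∃ m', R m m' ∧ pos m' = (w, j)) ∧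
      ∀ ms : ℕ → M, ms 0 = m₀ → (∀ n, R (ms n) (ms (n + 1))) →
        S.ParityWin fun n => (pos (ms n)).2 := by
  unfold solution
  rw [Set.mem_ofPred_eq, Arena.mem_winningRegion_iff]
  constructor
  · rintro ⟨M, pos, R, m₀, h0, hE, hU, hα⟩
    refine ⟨{p : M × (N × Fin k) // pos p.1 = .inl p.2}, fun p => p.1.2,
      fun p p' => ∃ m A, R p.1.1 m ∧ R m p'.1.1 ∧ pos m = .inr A, ⟨(m₀, v, i), h0⟩, rfl, ?_, ?_⟩
    · rintro ⟨⟨m, s, l⟩, hm⟩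
      obtain ⟨m₁, h1, h2⟩ := hE m (by rw [hm]; exact ⟨_, rfl⟩)
      rw [hm] at h2
      rcases h5 : pos m₁ with p | A
      · rw [h5] at h2; exact h2.elim
      · rw [h5] at h2
        refine ⟨A, h2, fun w j hw => ?_⟩
        obtain ⟨m₂, h3, h4⟩ := hU m₁ (by rw [h5]; rintro ⟨_, ⟨⟩⟩) (.inl (w, j))
          (by rw [h5]; exact hw)
        exact ⟨⟨(m₂, w, j), h4⟩, ⟨m₁, A, h1, h3, h5⟩, rfl⟩
    · intro ms hms hR
      choose b A hb1 hb2 hA using hR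
      have := hα (interleave (fun n => (ms n).1.1) b)
        (by rw [show 0 = 2 * 0 by rfl, interleave_even]; simp [hms]) (interleave_chain hb1 hb2)
      refine (S.mem_objective_iff (a := fun n => (ms n).1.2) (fun n => ?_) (fun n p => ?_)).1 this
      · rw [Function.comp_apply, interleave_even, (ms n).2]
      · rw [Function.comp_apply, interleave_odd, hA]; rintro ⟨⟩
  · rintro ⟨M, pos, R, m₀, h0, hm, hα⟩
    -- A memory state at a tuple `A` carries the guarantee that every universal reply from `A` can
    -- be followed.
    let Q : Type u := {p : M × (Fin k → Set N) //
      ∀ w j, w ∈ p.2 j → ∃ m', R p.1 m' ∧ pos m' = (w, j)}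
    let R' : M ⊕ Q → M ⊕ Q → Prop
      | .inl m, .inr p => p.1.1 = m
      | .inr p, .inl m' => R p.1.1 m'
      | _, _ => False
    refine ⟨M ⊕ Q, Sum.elim (fun m => .inl (pos m)) (fun p => .inr p.1.2), R',
      .inl m₀, by simp [h0], ?_, ?_, ?_⟩
    · rintro (m | ⟨m, x⟩) hx
      · obtain ⟨A, h1, h2⟩ := hm m
        exact ⟨.inr ⟨(m, A), h2⟩, rfl, h1⟩
      · obtain ⟨_, ⟨⟩⟩ := hx
    · rintro (m | ⟨⟨m, A⟩, hA⟩) hx w hw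
      · exact (hx ⟨_, rfl⟩).elim
      · rcases w with ⟨w, j⟩ | B
        · obtain ⟨m', h1, h2⟩ := hA w j hw
          exact ⟨.inl m', h1, by simp [h2]⟩
        · exact hw.elim
    · intro ms hms hR
      have step : ∀ n m, ms n = .inl m →
          ∃ m' q, ms (n + 2) = .inl m' ∧ R m m' ∧ ms (n + 1) = .inr q := by
        intro n m hn
        have h1 := hR n
        have h2 := hR (n + 1)
        rw [hn] at h1
        rcases h3 : ms (n + 1) with m₁ | p
        · rw [h3] at h1; exact h1.elim
        · rw [h3] at h1 h2
          obtain rfl : p.1.1 = m := h1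
          rcases h4 : ms (n + 1 + 1) with m₂ | q
          · rw [h4] at h2; exact ⟨m₂, p, rfl, h2, rfl⟩
          · rw [h4] at h2; exact h2.elim
      have hev : ∀ n, ∃ m, ms (2 * n) = .inl m := by
        intro n
        induction n with
        | zero => exact ⟨m₀, hms⟩
        | succ n ih =>
          obtain ⟨m, hm⟩ := ih
          obtain ⟨m', -, h, -⟩ := step _ _ hm
          exact ⟨m', h⟩
      choose a ha using hev
      refine (S.mem_objective_iff (a := fun n => pos (a n)) (fun n => by simp [ha])
        (fun n p => ?_)).2 (hα a ?_ fun n => ?_)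
      · obtain ⟨m', q, -, -, hq⟩ := step _ _ (ha n)
        simp [hq]
      · exact Sum.inl_injective ((ha 0).symm.trans hms)
      · obtain ⟨m', -, h, hr, -⟩ := step _ _ (ha n)
        rwa [Sum.inl_injective ((ha (n + 1)).symm.trans h)]

end FixSystem

/-! ### Emerson-Lei formulas and colors -/

theorem BForm.toLTL_sat {AP : Type*} (w : ℕ → AP → Bool) (ψ : BForm AP) (i : ℕ) :
    ψ.toLTL.Sat w i ↔ SymbolicGame.NodeSat (w i) ψ := by
  unfold SymbolicGame.NodeSat
  induction ψ with
  | tt => rfl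
  | ff => rfl
  | atom p => rfl
  | neg ψ ih => exact not_congr ih
  | conj ψ₁ ψ₂ ih₁ ih₂ => exact and_congr ih₁ ih₂
  | disj ψ₁ ψ₂ ih₁ ih₂ => exact or_congr ih₁ ih₂

/-- Serves to make the set of colors finite, as a preimage of the finite set of subformulas. -/
theorem BForm.toLTL_injective {AP : Type*} : Function.Injective (BForm.toLTL (AP := AP)) := by
  intro φ
  induction φ with
  | tt => rintro (_ | _ | _ | _ | _ | _) h <;> simp_all [BForm.toLTL]
  | ff => rintro (_ | _ | _ | _ | _ | _) h <;> simp_all [BForm.toLTL]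
  | atom p => rintro (_ | _ | _ | _ | _ | _) h <;> simp_all [BForm.toLTL]
  | neg ψ ih =>
    rintro (_ | _ | _ | _ | _ | _) h <;> simp only [BForm.toLTL, LTL.neg.injEq, reduceCtorEq] at h
    rw [ih h]
  | conj ψ₁ ψ₂ ih₁ ih₂ =>
    rintro (_ | _ | _ | _ | _ | _) h <;> simp only [BForm.toLTL, LTL.conj.injEq, reduceCtorEq] at h
    rw [ih₁ h.1, ih₂ h.2]
  | disj ψ₁ ψ₂ ih₁ ih₂ =>
    rintro (_ | _ | _ | _ | _ | _) h <;> simp only [BForm.toLTL, LTL.disj.injEq, reduceCtorEq] at h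
    rw [ih₁ h.1, ih₂ h.2]

theorem LTL.self_mem_subformulas {AP : Type*} (φ : LTL AP) : φ ∈ φ.subformulas := by
  cases φ <;> simp [LTL.subformulas]

theorem LTL.subformulas_finite {AP : Type*} (φ : LTL AP) : φ.subformulas.Finite := by
  induction φ <;> simp_all [LTL.subformulas]

theorem boolSubformulas_finite {AP : Type*} (φ : ELFormula (BForm AP)) :
    (boolSubformulas φ).Finite :=
  (elToLTL φ).subformulas_finite.preimage BForm.toLTL_injective.injOn

/-- An Emerson-Lei condition only depends on the set of colors seen infinitely often. -/
theorem elToLTL_sat {AP : Type*} (w : ℕ → AP → Bool) {C : Set (BForm AP)}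
    (φ : ELFormula (BForm AP)) (hC : boolSubformulas φ ⊆ C) (i : ℕ) :
    (elToLTL φ).Sat w i ↔ φ.Sat {c ∈ C | ∃ᶠ n in atTop, c ∈ coloring C (w n)} := by
  induction φ with
  | tt => rfl
  | ff => rfl
  | atom ψ =>
    have hψ : ψ ∈ C := hC (by
      simp [boolSubformulas, elToLTL, LTL.subformulas, LTL.self_mem_subformulas])
    simp only [elToLTL, LTL.Sat, BForm.toLTL_sat, BForm.Sat, coloring, Set.mem_ofPred_eq, hψ,
      true_and, frequently_atTop]
    constructor
    · intro h a
      obtain ⟨j, hj, hs⟩ := h (max a i) (le_max_right _ _)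
      exact ⟨j, (le_max_left _ _).trans hj, hs⟩
    · exact fun h j _ => h j
  | neg ψ ih =>
    exact not_congr (ih fun c hc => hC (by
      simp only [boolSubformulas, elToLTL, LTL.subformulas, Set.mem_ofPred_eq] at *
      exact Or.inr hc))
  | conj ψ₁ ψ₂ ih₁ ih₂ =>
    refine and_congr (ih₁ fun c hc => hC ?_) (ih₂ fun c hc => hC ?_) <;>
    simp only [boolSubformulas, elToLTL, LTL.subformulas, Set.mem_ofPred_eq] at *
    · exact Or.inr (Or.inl hc)
    · exact Or.inr (Or.inr hc)
  | disj ψ₁ ψ₂ ih₁ ih₂ =>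
    refine or_congr (ih₁ fun c hc => hC ?_) (ih₂ fun c hc => hC ?_) <;>
    simp only [boolSubformulas, elToLTL, LTL.subformulas, Set.mem_ofPred_eq] at *
    · exact Or.inr (Or.inl hc)
    · exact Or.inr (Or.inr hc)

/-! ### The Zielonka tree -/

namespace ZVertex

variable {Col : Type*} {φ : ELFormula Col} {C : Set Col}

/-- The depth of a vertex, starting from one at the root. -/
def depth (t : ZVertex φ C) : ℕ := t.1.length

theorem ne_nil (t : ZVertex φ C) : t.1 ≠ [] := by
  obtain ⟨p, hp⟩ := t
  cases hp <;> simp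

theorem depth_pos (t : ZVertex φ C) : 0 < t.depth := List.length_pos_iff.2 t.ne_nil

theorem Anc.refl (s : ZVertex φ C) : s.Anc s := List.suffix_refl _

theorem Anc.trans {s t u : ZVertex φ C} (h : s.Anc t) (h' : t.Anc u) : s.Anc u :=
  List.IsSuffix.trans h h'

theorem Anc.depth_le {s t : ZVertex φ C} (h : s.Anc t) : s.depth ≤ t.depth :=
  List.IsSuffix.length_le h

theorem Anc.eq_of_depth_le {s t : ZVertex φ C} (h : s.Anc t) (h' : t.depth ≤ s.depth) : s = t :=
  Subtype.ext (List.IsSuffix.eq_of_length_le h h')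

theorem Anc.anc_of_depth_le {s t u : ZVertex φ C} (hs : s.Anc u) (ht : t.Anc u)
    (h : s.depth ≤ t.depth) : s.Anc t :=
  List.suffix_of_suffix_length_le hs ht h

theorem depth_of_mem_children {s t : ZVertex φ C} (h : t ∈ s.children) :
    t.depth = s.depth + 1 := by
  obtain ⟨D, hD⟩ := h
  simp [depth, hD]

theorem anc_of_mem_children {s t : ZVertex φ C} (h : t ∈ s.children) : s.Anc t := by
  obtain ⟨D, hD⟩ := h
  unfold Anc
  rw [hD]
  exact List.suffix_cons D s.1

theorem eq_of_anc_of_anc_child {s s' t : ZVertex φ C} (ht : t ∈ s.children) (h1 : s.Anc s')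
    (h2 : s'.Anc t) (hne : s' ≠ s) : s' = t := by
  refine h2.eq_of_depth_le ?_
  rw [depth_of_mem_children ht]
  by_contra h
  exact hne (h1.eq_of_depth_le (by omega)).symm

theorem root_anc (t : ZVertex φ C) : (root φ C).Anc t := by
  obtain ⟨p, hp⟩ := t
  induction hp with
  | root => exact Anc.refl _
  | child hp _ ih => exact List.IsSuffix.trans ih (List.suffix_cons _ _)

theorem label_antitone {s t : ZVertex φ C} (h : s.Anc t) : t.label ⊆ s.label := by
  obtain ⟨p, hp⟩ := t
  induction hp with
  | root => rw [show s = root φ C from h.eq_of_depth_le s.depth_pos]; exact subset_rfl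
  | @child p D hp hD ih =>
    rcases List.suffix_cons_iff.1 h with h' | h'
    · obtain rfl : s = ⟨D :: p, .child hp hD⟩ := Subtype.ext h'
      exact subset_rfl
    · exact hD.prop.1.1.trans (ih h')

/-- `D` is a candidate for a child label, and among finitely many candidates it lies below a maximal
one. -/
theorem exists_child_superset (hC : C.Finite) (s : ZVertex φ C) {D : Set Col} (hD : D ⊆ s.label)
    (h : ¬ (φ.Sat D ↔ s.Winning)) : ∃ t ∈ s.children, D ⊆ t.label := by
  have hfin : {D' | D' ⊂ s.label ∧ (φ.Sat D' ↔ ¬ φ.Sat s.label)}.Finite := by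
    refine (hC.subset (label_antitone s.root_anc)).finite_subsets.subset fun D' h => h.1.1
  have hDmem : D ∈ {D' | D' ⊂ s.label ∧ (φ.Sat D' ↔ ¬ φ.Sat s.label)} := by
    refine ⟨hD.ssubset_of_ne ?_, by unfold Winning at h; tauto⟩
    rintro rfl
    exact h Iff.rfl
  obtain ⟨D', hle, hmax⟩ := hfin.exists_le_maximal hDmem
  exact ⟨⟨D' :: s.1, .child s.2 hmax⟩, ⟨D', rfl⟩, hle⟩

/-- The deepest ancestor of `t` whose label contains `γ v` is the anchor; the root is always a
candidate. -/
theorem exists_anchor [Finite (ZVertex φ C)] {N : Type*} (γ : N → Set Col) (v : N) (hv : γ v ⊆ C)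
    (t : ZVertex φ C) : ∃ s, s.Anc t ∧ v ∈ anchor γ s t := by
  obtain ⟨s, ⟨hs1, hs2⟩, hmax⟩ := Set.exists_max_image {s : ZVertex φ C | s.Anc t ∧ γ v ⊆ s.label}
    depth (Set.toFinite _) ⟨root φ C, t.root_anc, hv⟩
  refine ⟨s, hs1, hs2, fun u hu hut hvu => ?_⟩
  have := hmax u ⟨hut, hvu⟩
  have := depth_of_mem_children hu
  omega

/-- A run of the fixpoint game of an Emerson-Lei equation system. -/
structure IsRun {N : Type*} (γ : N → Set Col) (v : ℕ → N) (s : ℕ → ZVertex φ C) : Prop where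
  inner : ∀ i, (s i).children ≠ ∅ → v (i + 1) = v i ∧ s (i + 1) ∈ (s i).children
  leaf : ∀ i, (s i).children = ∅ → (s (i + 1)).Anc (s i) ∧ v i ∈ anchor γ (s (i + 1)) (s i)

theorem exists_depth_le [Finite (ZVertex φ C)] : ∃ B, ∀ t : ZVertex φ C, t.depth ≤ B := by
  obtain ⟨B, hB⟩ := (Set.finite_range (depth (φ := φ) (C := C))).bddAbove
  exact ⟨B, fun t => hB ⟨t, rfl⟩⟩

/-! ### The dominating vertex of a run -/

namespace IsRun

variable {N : Type*} {γ : N → Set Col} {v : ℕ → N} {s : ℕ → ZVertex φ C}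

/-- Steps at inner vertices increase the depth, which is bounded, and do not change the node. -/
theorem exists_leaf [Finite (ZVertex φ C)] (h : IsRun γ v s) (i : ℕ) :
    ∃ j, i ≤ j ∧ (s j).children = ∅ ∧ v j = v i := by
  obtain ⟨B, hB⟩ := exists_depth_le (φ := φ) (C := C)
  induction hn : B - (s i).depth using Nat.strong_induction_on generalizing i with
  | _ n ih =>
    by_cases hc : (s i).children = ∅
    · exact ⟨i, le_rfl, hc, rfl⟩
    · obtain ⟨h1, h2⟩ := h.inner i hc
      have h3 := depth_of_mem_children h2
      have h4 := hB (s (i + 1))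
      obtain ⟨j, hj, hl, hv⟩ := ih _ (by omega) (i + 1) rfl
      exact ⟨j, by omega, hl, hv.trans h1⟩

/-- A jump from a leaf below `r` ends at a vertex comparable with `r`. Once only recurring vertices
occur, it cannot end strictly above `r`. -/
theorem exists_min [Finite (ZVertex φ C)] (h : IsRun γ v s) {r : ZVertex φ C}
    (hr : ∃ᶠ i in atTop, s i = r)
    (hmin : ∀ t, (∃ᶠ i in atTop, s i = t) → t.Anc r → t = r) :
    ∀ᶠ i in atTop, r.Anc (s i) := by
  have hev : ∀ᶠ i in atTop, ∃ᶠ j in atTop, s j = s i := by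
    have : ∀ᶠ i in atTop, ∀ t, ¬ (∃ᶠ j in atTop, s j = t) → s i ≠ t := by
      rw [eventually_all]
      intro t
      by_cases ht : ∃ᶠ j in atTop, s j = t
      · simp [ht]
      · rw [not_frequently] at ht
        exact ht.mono fun _ hi _ => hi
    filter_upwards [this] with i hi
    by_contra hc
    exact hi _ hc rfl
  obtain ⟨n₀, hn₀⟩ := eventually_atTop.1 hev
  obtain ⟨n₁, hn₁, hs⟩ := frequently_atTop.1 hr n₀
  refine eventually_atTop.2 ⟨n₁, fun i hi => ?_⟩
  induction i, hi using Nat.le_induction with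
  | base => rw [hs]; exact Anc.refl _
  | succ i hi ih =>
    by_cases hc : (s i).children = ∅
    · have ha := (h.leaf i hc).1
      rcases le_total r.depth (s (i + 1)).depth with hd | hd
      · exact ih.anc_of_depth_le ha hd
      · rw [hmin _ (hn₀ (i + 1) (by omega)) (ha.anc_of_depth_le ih hd)]
        exact Anc.refl _
    · exact ih.trans (anc_of_mem_children (h.inner i hc).2)

/-- After the run moves from `r` to its child `t`, it leaves the subtree of `t` only by a node with
a color outside the label of `t`. -/
theorem exists_not_subset (h : IsRun γ v s) {r t : ZVertex φ C} {i j : ℕ}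
    (ht : t ∈ r.children) (hanc : ∀ l, i ≤ l → r.Anc (s l)) (hi : s (i + 1) = t)
    (hij : i < j) (hj : s j = r) : ∃ l, i < l ∧ ¬ γ (v l) ⊆ t.label := by
  by_contra! hcon
  have hd := depth_of_mem_children ht
  have key : ∀ l, i + 1 ≤ l → t.Anc (s l) := by
    intro l hl
    induction l, hl using Nat.le_induction with
    | base => rw [hi]; exact Anc.refl _
    | succ l hl ih =>
      by_cases hc : (s l).children = ∅
      · obtain ⟨ha, hv⟩ := h.leaf l hc
        -- A jump from below `t` to `r` requires, by the definition of the anchor, a color outside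
        -- the label of `t`.
        by_cases hr : s (l + 1) = r
        · rw [hr] at hv
          exact (hv.2 t ht ih (hcon l (by omega))).elim
        · rcases le_total t.depth (s (l + 1)).depth with hd | hd
          · exact ih.anc_of_depth_le ha hd
          · rw [eq_of_anc_of_anc_child ht (hanc (l + 1) (by omega)) (ha.anc_of_depth_le ih hd) hr]
            exact Anc.refl _
      · exact ih.trans (anc_of_mem_children (h.inner l hc).2)
  have := (key j hij).depth_le
  rw [hj] at this
  omega

/-- If all children of the dominating vertex `r` are visited infinitely often from `r`, then the set of
colors seen infinitely often satisfies `φ` if and only if `r` is winning. -/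
theorem sat_iff_winning [Finite (ZVertex φ C)] (hC : C.Finite) (h : IsRun γ v s)
    {r : ZVertex φ C} (hr : ∃ᶠ i in atTop, s i = r)
    (hmin : ∀ t, (∃ᶠ i in atTop, s i = t) → t.Anc r → t = r)
    (hrot : ∀ t ∈ r.children, ∃ᶠ i in atTop, s i = r ∧ s (i + 1) = t) (hγ : ∀ x, γ x ⊆ C) :
    φ.Sat {c ∈ C | ∃ᶠ i in atTop, c ∈ γ (v i)} ↔ r.Winning := by
  obtain ⟨n₀, hn₀⟩ := eventually_atTop.1 (h.exists_min hr hmin)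
  -- The node `v i` is still current at the next leaf, where its anchor lies below `r`.
  have hsub : ∀ i, n₀ ≤ i → γ (v i) ⊆ r.label := by
    intro i hi
    obtain ⟨j, hj, hl, hv⟩ := h.exists_leaf i
    rw [← hv]
    exact (h.leaf j hl).2.1.trans (label_antitone (hn₀ (j + 1) (by omega)))
  by_contra hcon
  obtain ⟨t, ht, hDt⟩ := exists_child_superset hC r (D := {c ∈ C | ∃ᶠ i in atTop, c ∈ γ (v i)})
    (by
      rintro c ⟨-, hc⟩
      obtain ⟨i, hi, hci⟩ := frequently_atTop.1 hc n₀
      exact hsub i hi hci) hcon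
  have hfreq : ∃ᶠ i in atTop, ∃ c ∈ C, c ∈ γ (v i) ∧ c ∉ t.label := by
    rw [frequently_atTop]
    intro n
    obtain ⟨i, hi, -, hit⟩ := frequently_atTop.1 (hrot t ht) (max n n₀)
    obtain ⟨j, hj, hjr⟩ := frequently_atTop.1 hr (i + 1)
    obtain ⟨l, hl, hlt⟩ := h.exists_not_subset ht
      (fun l hl => hn₀ l ((le_max_right n n₀).trans (hi.trans hl))) hit hj hjr
    obtain ⟨c, hc, hct⟩ := Set.not_subset.1 hlt
    exact ⟨l, (le_max_left n n₀).trans (hi.trans hl.le), c, hγ _ hc, hc, hct⟩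
  -- Pigeonhole over the finitely many colors: one and the same color outside `l(t)` recurs.
  have hex : ∃ c ∈ C, ∃ᶠ i in atTop, c ∈ γ (v i) ∧ c ∉ t.label := by
    by_contra hno
    push Not at hno
    refine hfreq ?_
    filter_upwards [(eventually_all_finite hC).2 hno] with i hi
    rintro ⟨c, hc, h1⟩
    exact h1.2 (hi c hc h1.1)
  obtain ⟨c, hc, hcf⟩ := hex
  obtain ⟨-, -, hct⟩ := hcf.exists
  exact hct (hDt ⟨hc, hcf.mono fun _ h => h.1⟩)

end IsRun

/-! ### Visiting the children in rotation -/

theorem exists_rotation [Finite (ZVertex φ C)] :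
    ∃ f : ZVertex φ C → ℕ → ZVertex φ C, ∀ s : ZVertex φ C, s.children ≠ ∅ →
      (∀ n, f s n ∈ s.children) ∧ ∀ t ∈ s.children, ∃ᶠ n in atTop, f s n = t := by
  have : ∀ s : ZVertex φ C, ∃ g : ℕ → ZVertex φ C, s.children ≠ ∅ →
      (∀ n, g n ∈ s.children) ∧ ∀ t ∈ s.children, ∃ᶠ n in atTop, g n = t := by
    intro s
    by_cases hs : s.children = ∅
    · exact ⟨fun _ => s, fun h => (h hs).elim⟩
    · have : Nonempty s.children := (Set.nonempty_iff_ne_empty.2 hs).to_subtype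
      obtain ⟨g, hg⟩ := exists_surjective_nat s.children
      -- Decoding a pair repeats every value of the enumeration `g` infinitely often.
      refine ⟨fun n => g n.unpair.1, fun _ => ⟨fun n => (g _).2, fun t ht => ?_⟩⟩
      obtain ⟨a, ha⟩ := hg ⟨t, ht⟩
      rw [frequently_atTop]
      exact fun n => ⟨Nat.pair a n, Nat.right_le_pair a n, by simp [ha]⟩
  choose f hf using this
  exact ⟨f, hf⟩

open Classical in
/-- Vertices visited so far are counted by `c`. -/
theorem frequently_of_rotation {T : Type*} {s : ℕ → T} {c : ℕ → T → ℕ} {f : ℕ → T} {r t : T}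
    (h0 : c 0 r = 0) (hc : ∀ i, c (i + 1) = Function.update (c i) (s i) (c i (s i) + 1))
    (hr : ∃ᶠ i in atTop, s i = r) (hf : ∀ i, s i = r → s (i + 1) = f (c i r))
    (ht : ∃ᶠ n in atTop, f n = t) : ∃ᶠ i in atTop, s i = r ∧ s (i + 1) = t := by
  have hcount : ∀ i, c i r = Nat.count (fun j => s j = r) i := by
    intro i
    induction i with
    | zero => simp [h0]
    | succ i ih =>
      rw [hc, Nat.count_succ, ← ih]
      by_cases h : s i = r
      · subst h; simp
      · rw [Function.update_of_ne (Ne.symm h)]; simp [h]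
  have hinf : (Set.ofPred fun j => s j = r).Infinite := Nat.frequently_atTop_iff_infinite.1 hr
  rw [frequently_atTop]
  intro n
  obtain ⟨m, hm, hft⟩ := frequently_atTop.1 ht n
  have hs := Nat.nth_mem_of_infinite hinf m
  -- At visit number `m` (from zero) to `r` the counter equals `m`, so the next vertex is `f m = t`.
  refine ⟨Nat.nth (fun j => s j = r) m, ?_, hs, ?_⟩
  · exact hm.trans ((Nat.nth_strictMono hinf).id_le m)
  · rw [hf _ hs, hcount, Nat.count_nth_of_infinite hinf, hft]

end ZVertex

/-! ### Removing repetitions from a sequence -/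

/-- The index on the left is the first position from `i` on that satisfies `p`, and `a` can change
only after such a position. For runs, `p` marks the leaves. -/
theorem eq_nth_count {X : Type*} {p : ℕ → Prop} [DecidablePred p] (hp : (Set.ofPred p).Infinite)
    {a : ℕ → X} (ha : ∀ i, ¬ p i → a (i + 1) = a i) (i : ℕ) :
    a (Nat.nth p (Nat.count p i)) = a i := by
  have key : ∀ j, i ≤ j → j ≤ Nat.nth p (Nat.count p i) → a j = a i := by
    intro j hj
    induction j, hj using Nat.le_induction with
    | base => intro _; rfl
    | succ j hj ih =>
      intro hle
      rw [ha j fun hpj => ?_, ih (by omega)]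
      have h1 := Nat.nth_monotone hp (Nat.count_monotone p hj)
      rw [Nat.nth_count hpj] at h1
      omega
  exact key _ (Nat.le_nth_count hp i) le_rfl

theorem frequently_nth_iff {X : Type*} {p : ℕ → Prop} (hp : (Set.ofPred p).Infinite)
    {a : ℕ → X} (ha : ∀ i, ¬ p i → a (i + 1) = a i) (P : X → Prop) :
    (∃ᶠ n in atTop, P (a (Nat.nth p n))) ↔ ∃ᶠ i in atTop, P (a i) := by
  classical
  simp only [frequently_atTop]
  constructor
  · intro h b
    obtain ⟨n, hn, hP⟩ := h b
    exact ⟨_, hn.trans ((Nat.nth_strictMono hp).id_le n), hP⟩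
  · intro h b
    obtain ⟨i, hi, hP⟩ := h (Nat.nth p b)
    refine ⟨Nat.count p i, ?_, by rwa [eq_nth_count hp ha]⟩
    rw [← Nat.count_nth_of_infinite hp b]
    exact Nat.count_monotone p hi

/-! ### From the fixpoint game to the symbolic game and back -/

namespace ZVertex

variable {Col : Type*} {φ : ELFormula Col} {C : Set Col} {N : Type*} {γ : N → Set Col}

theorem mem_rhs_of_leaf {cpre : Set N →o Set N} {s : ZVertex φ C} (hs : s.children = ∅)
    {X : ZVertex φ C → Set N} {v : N} :
    v ∈ s.rhs γ cpre X ↔ ∃ s' : ZVertex φ C, s'.Anc s ∧ v ∈ anchor γ s' s ∧ v ∈ cpre (X s') := by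
  simp only [rhs, hs, if_true, Set.mem_iUnion, Set.mem_inter_iff, exists_prop, Set.mem_ofPred_eq]

theorem mem_rhs_of_winning {cpre : Set N →o Set N} {s : ZVertex φ C} (hs : s.children ≠ ∅)
    (hw : s.Winning) {X : ZVertex φ C → Set N} {v : N} :
    v ∈ s.rhs γ cpre X ↔ ∀ t ∈ s.children, v ∈ X t := by
  simp [rhs, hs, hw]

theorem mem_rhs_of_losing {cpre : Set N →o Set N} {s : ZVertex φ C} (hs : s.children ≠ ∅)
    (hw : ¬ s.Winning) {X : ZVertex φ C → Set N} {v : N} :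
    v ∈ s.rhs γ cpre X ↔ ∃ t ∈ s.children, v ∈ X t := by
  simp [rhs, hs, hw]

theorem IsRun.infinite_leaf [Finite (ZVertex φ C)] {v : ℕ → N} {s : ℕ → ZVertex φ C}
    (h : IsRun γ v s) : (Set.ofPred fun i => (s i).children = ∅).Infinite := by
  refine Nat.frequently_atTop_iff_infinite.1 (frequently_atTop.2 fun i => ?_)
  obtain ⟨j, hj, hl, -⟩ := h.exists_leaf i
  exact ⟨j, hj, hl⟩

theorem kind_eq_gfp_iff (s : ZVertex φ C) : s.kind = .gfp ↔ s.Winning := by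
  unfold kind
  split_ifs with h <;> simp [h]

end ZVertex

/-! ### The two inclusions -/

section

open ZVertex

theorem coloring_subset {Var : Type*} (C : Set (BForm Var)) (s : Var → Bool) : coloring C s ⊆ C :=
  fun _ h => h.1

variable {Var : Type*} {G : SymbolicGame Var} {φ : ELFormula (BForm Var)} {k : ℕ}
  {C : Set (BForm Var)} {e : ZVertex φ C ≃ Fin k}

open Classical in
-- The starting vertex `r` is arbitrary, since only the vertices and colors that recur matter.
theorem solution_subset_winningRegion
    (hwin : ∀ w : ℕ → Var → Bool, G.win.Sat w 0 ↔ (elToLTL φ).Sat w 0)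
    (hC : boolSubformulas φ ⊆ C) (hfin : C.Finite)
    (he : ∀ s t, s.Anc t → e s ≤ e t) (r : ZVertex φ C) :
    (elSystem e (coloring C) G.cpre).solution (e r) ⊆ G.winningRegion := by
  intro v₀ hv₀
  obtain ⟨M, pos, R, m₀, h0, hm, hα⟩ := (FixSystem.mem_solution_iff _ _ _).1 hv₀
  rw [SymbolicGame.mem_winningRegion_iff]
  have : Finite (ZVertex φ C) := Finite.of_equiv _ e.symm
  obtain ⟨f, hf⟩ := exists_rotation (φ := φ) (C := C)
  obtain ⟨B, hB⟩ := exists_depth_le (φ := φ) (C := C)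
  let nd : M → Var → Bool := fun m => (pos m).1
  let vt : M → ZVertex φ C := fun m => e.symm (pos m).2
  have hrhs : ∀ m, ∃ A : ZVertex φ C → Set (Var → Bool),
      nd m ∈ (vt m).rhs (coloring C) G.cpre A ∧
      ∀ w t, w ∈ A t → ∃ m', R m m' ∧ nd m' = w ∧ vt m' = t := by
    intro m
    obtain ⟨A, hA, hs⟩ := hm m
    refine ⟨fun t => A (e t), hA, fun w t hw => ?_⟩
    obtain ⟨m', h1, h2⟩ := hs w (e t) hw
    exact ⟨m', h1, by simp [nd, h2], by simp [vt, h2]⟩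
  have hdown : ∀ (m : M) (n : ℕ), (vt m).children ≠ ∅ → ∃ m', R m m' ∧ nd m' = nd m ∧
      vt m' ∈ (vt m).children ∧ ((vt m).Winning → vt m' = f (vt m) n) := by
    intro m n hc
    obtain ⟨A, hA, hs⟩ := hrhs m
    by_cases hw : (vt m).Winning
    · rw [mem_rhs_of_winning hc hw] at hA
      obtain ⟨m', h1, h2, h3⟩ := hs _ _ (hA _ ((hf _ hc).1 n))
      exact ⟨m', h1, h2, h3 ▸ (hf _ hc).1 n, fun _ => h3⟩
    · rw [mem_rhs_of_losing hc hw] at hA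
      obtain ⟨t, ht, hv⟩ := hA
      obtain ⟨m', h1, h2, h3⟩ := hs _ _ hv
      exact ⟨m', h1, h2, h3 ▸ ht, fun h => (hw h).elim⟩
  have hleaf : ∀ (m : M) (x : G.In), (vt m).children = ∅ → ∃ m', ∃ y, R m m' ∧
      (vt m').Anc (vt m) ∧ nd m ∈ anchor (coloring C) (vt m') (vt m) ∧
      nd m' = G.join x y ∧ G.Trans (nd m) (nd m') := by
    intro m x hc
    obtain ⟨A, hA, hs⟩ := hrhs m
    rw [mem_rhs_of_leaf hc] at hA
    obtain ⟨s', hs1, hs2, hs3⟩ := hA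
    obtain ⟨y, hy, ht⟩ := hs3 x
    obtain ⟨m', h1, h2, h3⟩ := hs _ _ hy
    exact ⟨m', y, h1, h3 ▸ hs1, h3 ▸ hs2, h2, h2 ▸ ht⟩
  choose d hd1 hd2 hd3 hd4 using hdown
  choose g y hg1 hg2 hg3 hg4 hg5 using hleaf
  -- The counters record the visits to each vertex and drive the rotation. One round of the symbolic
  -- game is `desc` iterated down to a leaf, then one `climb` with the given input.
  let Q := M × (ZVertex φ C → ℕ)
  let bump : Q → M → Q := fun q m => (m, Function.update q.2 (vt q.1) (q.2 (vt q.1) + 1))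
  let desc : Q → Q := fun q =>
    if h : (vt q.1).children = ∅ then q else bump q (d q.1 (q.2 (vt q.1)) h)
  let climb : Q → G.In → Q := fun q x =>
    if h : (vt q.1).children = ∅ then bump q (g q.1 x h) else q
  have hdl : ∀ q : Q, (vt q.1).children = ∅ → desc q = q := fun q h => dif_pos h
  have hdi : ∀ (q : Q) (h : (vt q.1).children ≠ ∅), desc q = bump q (d q.1 (q.2 (vt q.1)) h) :=
    fun q h => dif_neg h
  have hcl : ∀ (q : Q) x (h : (vt q.1).children = ∅), climb q x = bump q (g q.1 x h) :=
    fun q x h => dif_pos h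
  have hnd : ∀ q, nd (desc q).1 = nd q.1 := by
    intro q
    by_cases h : (vt q.1).children = ∅
    · rw [hdl q h]
    · rw [hdi q h]; exact hd2 ..
  have hndB : ∀ n q, nd (desc^[n] q).1 = nd q.1 := by
    intro n
    induction n with
    | zero => intro q; rfl
    | succ n ih => intro q; rw [Function.iterate_succ_apply, ih, hnd]
  -- With the depth bound `B`, this shows that `B` descents reach a leaf from any state; further
  -- ones do nothing there.
  have hdepth : ∀ n q, (vt (desc^[n] q).1).children = ∅ ∨ n < (vt (desc^[n] q).1).depth := by
    intro n
    induction n with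
    | zero => exact fun q => Or.inr (depth_pos _)
    | succ n ih =>
      intro q
      rw [Function.iterate_succ_apply']
      by_cases h : (vt (desc^[n] q).1).children = ∅
      · rw [hdl _ h]; exact Or.inl h
      · right
        have h1 := (ih q).resolve_left h
        rw [hdi _ h]
        have h2 := depth_of_mem_children (hd3 (desc^[n] q).1
          ((desc^[n] q).2 (vt (desc^[n] q).1)) h)
        exact lt_of_lt_of_eq (Nat.succ_lt_succ h1) h2.symm
  have hBl : ∀ q, (vt (desc^[B] q).1).children = ∅ := fun q =>
    (hdepth B q).resolve_right (hB _).not_gt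
  have hBd : ∀ q, desc^[B] (desc q) = desc^[B] q := by
    intro q
    rw [← Function.iterate_succ_apply, Function.iterate_succ_apply', hdl _ (hBl q)]
  have hBc : ∀ q : Q, (vt q.1).children = ∅ → desc^[B] q = q := fun q h =>
    Function.iterate_fixed (hdl q h) B
  refine ⟨Q, fun q => nd q.1, fun q q' => ∃ x, q' = climb (desc^[B] q) x, (m₀, 0), by simp [nd, h0],
    ?_, ?_⟩
  · intro q x
    refine ⟨_, y _ x (hBl q), ⟨x, rfl⟩, ?_, ?_⟩
    · rw [hcl _ _ (hBl q)]; exact hg4 ..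
    · dsimp only; rw [hcl _ _ (hBl q), ← hndB B q]; exact hg5 ..
  · intro qs hq0 hR
    choose xs hxs using hR
    -- `F` unrolls the rounds into single steps of the fixpoint game; its second component counts
    -- the completed rounds.
    let F : ℕ → Q × ℕ := fun i => Nat.rec (qs 0, 0) (fun _ p =>
      if (vt p.1.1).children = ∅ then (climb p.1 (xs p.2), p.2 + 1) else (desc p.1, p.2)) i
    have hF0 : F 0 = (qs 0, 0) := rfl
    have hFl : ∀ i, (vt (F i).1.1).children = ∅ →
        F (i + 1) = (climb (F i).1 (xs (F i).2), (F i).2 + 1) := fun i h => if_pos h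
    have hFi : ∀ i, (vt (F i).1.1).children ≠ ∅ → F (i + 1) = (desc (F i).1, (F i).2) :=
      fun i h => if_neg h
    -- Within a round, the current state and the state at the start of the round descend to the same
    -- leaf state.
    have hinv : ∀ i, desc^[B] (F i).1 = desc^[B] (qs (F i).2) := by
      intro i
      induction i with
      | zero => rfl
      | succ i ih =>
        by_cases h : (vt (F i).1.1).children = ∅
        · rw [hFl i h]
          dsimp only
          rw [hxs, ← ih, hBc _ h]
        · rw [hFi i h]
          dsimp only
          rw [hBd, ih]
    have hcnt : ∀ i, (F i).2 = Nat.count (fun i => (vt (F i).1.1).children = ∅) i := by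
      intro i
      induction i with
      | zero => rfl
      | succ i ih =>
        rw [Nat.count_succ, ← ih]
        by_cases h : (vt (F i).1.1).children = ∅
        · rw [hFl i h, if_pos h]
        · rw [hFi i h, if_neg h, add_zero]
    have hbump : ∀ i, ∃ m', (F (i + 1)).1 = bump (F i).1 m' := by
      intro i
      by_cases h : (vt (F i).1.1).children = ∅
      · rw [hFl i h]; exact ⟨_, hcl _ _ h⟩
      · rw [hFi i h]; exact ⟨_, hdi _ h⟩
    have hrun : IsRun (coloring C) (fun i => nd (F i).1.1) (fun i => vt (F i).1.1) := by
      constructor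
      · intro i h
        rw [hFi i h, hdi _ h]
        exact ⟨hd2 .., hd3 ..⟩
      · intro i h
        rw [hFl i h, hcl _ _ h]
        exact ⟨hg2 .., hg3 ..⟩
    obtain ⟨i, hi, hmin, hk⟩ := hα (fun i => (F i).1.1) (by rw [hF0, hq0]) (fun i => by
      by_cases h : (vt (F i).1.1).children = ∅
      · rw [hFl i h, hcl _ _ h]; exact hg1 ..
      · rw [hFi i h, hdi _ h]; exact hd1 ..)
    have hW : (e.symm i).Winning := (kind_eq_gfp_iff _).1 hk
    have hri : ∃ᶠ j in atTop, vt (F j).1.1 = e.symm i := hi.mono fun j hj => by simp [vt, hj]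
    have hsat := (hrun.sat_iff_winning hfin hri
      (by
        intro t ht hta
        have h1 : i ≤ e t := hmin _ (ht.mono fun j hj => by simp [← hj, vt])
        have h2 := he _ _ hta
        rw [e.apply_symm_apply] at h2
        rw [← le_antisymm h2 h1, e.symm_apply_apply])
      (by
        intro t ht
        have hc : (e.symm i).children ≠ ∅ := Set.nonempty_iff_ne_empty.1 ⟨t, ht⟩
        refine frequently_of_rotation (c := fun i => (F i).1.2) (f := f (e.symm i))
          (by rw [hF0, hq0]; rfl) (fun j => ?_) hri (fun j hj => ?_) ((hf _ hc).2 t ht)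
        · obtain ⟨m', hm'⟩ := hbump j
          rw [hm']
        · have hcj : (vt (F j).1.1).children ≠ ∅ := by rw [hj]; exact hc
          rw [hFi j hcj, hdi _ hcj]
          refine (hd4 _ _ hcj (by rw [hj]; exact hW)).trans ?_
          rw [hj])
      (coloring_subset C)).2 hW
    rw [hwin, elToLTL_sat (C := C) _ _ hC]
    convert hsat using 4 with c
    rw [← frequently_nth_iff hrun.infinite_leaf (a := fun i => nd (F i).1.1)
      (fun i h => (hrun.inner i h).1) (fun v => c ∈ coloring C v)]
    have heq : ∀ n, nd (F (Nat.nth (fun i => (vt (F i).1.1).children = ∅) n)).1.1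
        = nd (qs n).1 := by
      intro n
      rw [← hndB B, hinv, hndB, hcnt, Nat.count_nth_of_infinite hrun.infinite_leaf]
    simp only [heq]
    rfl

theorem winningRegion_subset_solution
    (hwin : ∀ w : ℕ → Var → Bool, G.win.Sat w 0 ↔ (elToLTL φ).Sat w 0)
    (hC : boolSubformulas φ ⊆ C) (hfin : C.Finite)
    (he : ∀ s t, s.Anc t → e s ≤ e t) (r : ZVertex φ C) :
    G.winningRegion ⊆ (elSystem e (coloring C) G.cpre).solution (e r) := by
  classical
  intro v₀ hv₀
  obtain ⟨M, pos, R, m₀, h0, hm, hα⟩ := (SymbolicGame.mem_winningRegion_iff _ _).1 hv₀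
  rw [FixSystem.mem_solution_iff]
  have : Finite (ZVertex φ C) := Finite.of_equiv _ e.symm
  obtain ⟨f, hf⟩ := exists_rotation (φ := φ) (C := C)
  let Q := M × ZVertex φ C × (ZVertex φ C → ℕ)
  let bump : Q → ZVertex φ C → ℕ := fun q => Function.update q.2.2 q.2.1 (q.2.2 q.2.1 + 1)
  -- The allowed updates: at a leaf, a round of the given strategy and a jump to the anchor; at an
  -- inner vertex, a descent, which follows the rotation if the vertex is losing.
  let P : Q → M → ZVertex φ C → Prop := fun q m t =>
    if q.2.1.children = ∅ then
      R q.1 m ∧ t.Anc q.2.1 ∧ pos q.1 ∈ anchor (coloring C) t q.2.1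
    else m = q.1 ∧ t ∈ q.2.1.children ∧ (¬ q.2.1.Winning → t = f q.2.1 (q.2.2 q.2.1))
  have hPl : ∀ q m t, q.2.1.children = ∅ → (P q m t ↔
      R q.1 m ∧ t.Anc q.2.1 ∧ pos q.1 ∈ anchor (coloring C) t q.2.1) :=
    fun q m t h => by simp only [P, if_pos h]
  have hPi : ∀ q m t, q.2.1.children ≠ ∅ → (P q m t ↔
      m = q.1 ∧ t ∈ q.2.1.children ∧ (¬ q.2.1.Winning → t = f q.2.1 (q.2.2 q.2.1))) :=
    fun q m t h => by simp only [P, if_neg h]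
  refine ⟨Q, fun q => (pos q.1, e q.2.1), fun q q' => P q q'.1 q'.2.1 ∧ q'.2.2 = bump q,
    (m₀, r, 0), by simp [h0], fun q => ?_, fun qs hq0 hR => ?_⟩
  -- The tuple offered consists of just the positions reached by allowed updates, so that every
  -- universal reply can be followed.
  · refine ⟨fun j => {w | ∃ m, P q m (e.symm j) ∧ pos m = w}, ?_, ?_⟩
    · simp only [elSystem, e.symm_apply_apply]
      by_cases hc : q.2.1.children = ∅
      · rw [mem_rhs_of_leaf hc]
        obtain ⟨s, hs, ha⟩ := exists_anchor (coloring C) (pos q.1) (coloring_subset C _) q.2.1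
        refine ⟨s, hs, ha, fun x => ?_⟩
        obtain ⟨m, y, h1, h2, h3⟩ := hm q.1 x
        exact ⟨y, ⟨m, (hPl _ _ _ hc).2 ⟨h1, hs, ha⟩, h2⟩, h2 ▸ h3⟩
      · by_cases hw : q.2.1.Winning
        · rw [mem_rhs_of_winning hc hw]
          exact fun t ht => ⟨q.1, (hPi _ _ _ hc).2 ⟨rfl, ht, fun h => (h hw).elim⟩, rfl⟩
        · rw [mem_rhs_of_losing hc hw]
          have hmem := (hf _ hc).1 (q.2.2 q.2.1)
          exact ⟨_, hmem, q.1, (hPi _ _ _ hc).2 ⟨rfl, hmem, fun _ => rfl⟩, rfl⟩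
    · rintro w j ⟨m, h1, rfl⟩
      exact ⟨(m, e.symm j, bump q), ⟨h1, rfl⟩, by simp⟩
  · have hrun : IsRun (coloring C) (fun i => pos (qs i).1) (fun i => (qs i).2.1) := by
      constructor
      · intro i h
        obtain ⟨h1, h2, -⟩ := (hPi _ _ _ h).1 (hR i).1
        exact ⟨by simp [h1], h2⟩
      · intro i h
        exact ((hPl _ _ _ h).1 (hR i).1).2
    have hinf := hrun.infinite_leaf
    have hconst : ∀ i, ¬ (qs i).2.1.children = ∅ → (qs (i + 1)).1 = (qs i).1 :=
      fun i h => ((hPi _ _ _ h).1 (hR i).1).1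
    -- Sampled at the leaves, the memory follows the given strategy of the symbolic game.
    have hsat := hα (fun n => (qs (Nat.nth (fun i => (qs i).2.1.children = ∅) n)).1)
      (by
        have := eq_nth_count hinf (a := fun i => (qs i).1) hconst 0
        rw [Nat.count_zero] at this
        rw [this, hq0])
      (by
        intro n
        have hl := Nat.nth_mem_of_infinite hinf n
        have h1 := ((hPl _ _ _ hl).1 (hR _).1).1
        have h2 := eq_nth_count hinf (a := fun i => (qs i).1) hconst
          (Nat.nth (fun i => (qs i).2.1.children = ∅) n + 1)
        rw [Nat.count_succ, if_pos hl, Nat.count_nth_of_infinite hinf] at h2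
        rwa [h2])
    rw [hwin, elToLTL_sat (C := C) _ _ hC] at hsat
    have hfreq : ∀ c, (∃ᶠ n in atTop, c ∈ coloring C
        ((pos ∘ fun n => (qs (Nat.nth (fun i => (qs i).2.1.children = ∅) n)).1) n)) ↔
        ∃ᶠ i in atTop, c ∈ coloring C (pos (qs i).1) := fun c =>
      frequently_nth_iff hinf (a := fun i => (qs i).1) hconst (fun m => c ∈ coloring C (pos m))
    simp only [hfreq] at hsat
    -- Since there are finitely many indices, some index recurs, and a minimal recurring one exists.
    have hne : {j | ∃ᶠ n in atTop, e (qs n).2.1 = j}.Nonempty := by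
      by_contra hne
      rw [Set.not_nonempty_iff_eq_empty, Set.eq_empty_iff_forall_notMem] at hne
      have hall : ∀ᶠ n in atTop, ∀ j, e (qs n).2.1 ≠ j :=
        eventually_all.2 fun j => not_frequently.1 (hne j)
      obtain ⟨n, hn⟩ := hall.exists
      exact hn _ rfl
    obtain ⟨i, hi, hmin⟩ := Set.exists_min_image _ id (Set.toFinite _) hne
    refine ⟨i, hi, hmin, (kind_eq_gfp_iff _).2 ?_⟩
    by_contra hW
    have hri : ∃ᶠ j in atTop, (qs j).2.1 = e.symm i := by
      refine Frequently.mono hi fun j hj => ?_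
      rw [← hj, e.symm_apply_apply]
    refine hW ((hrun.sat_iff_winning hfin hri ?_ ?_ (coloring_subset C)).1 hsat)
    · intro t ht hta
      have h1 : i ≤ e t := hmin _ (Frequently.mono ht fun j hj => by simp [← hj])
      have h2 := he _ _ hta
      rw [e.apply_symm_apply] at h2
      rw [← le_antisymm h2 h1, e.symm_apply_apply]
    · intro t ht
      have hc : (e.symm i).children ≠ ∅ := Set.nonempty_iff_ne_empty.1 ⟨t, ht⟩
      refine frequently_of_rotation (c := fun i => (qs i).2.2) (f := f (e.symm i))
        (by rw [hq0]; rfl) (fun j => (hR j).2) hri (fun j hj => ?_) ((hf _ hc).2 t ht)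
      have hcj : (qs j).2.1.children ≠ ∅ := by rw [hj]; exact hc
      rw [((hPi _ _ _ hcj).1 (hR j).1).2.2 (by rw [hj]; exact hW), hj]

end

theorem mainTheorem7 {Var : Type*} [Finite Var] (G : SymbolicGame Var)
    (φ : ELFormula (BForm Var))
    (hwin : ∀ w : ℕ → Var → Bool, G.win.Sat w 0 ↔ (elToLTL φ).Sat w 0)
    {k : ℕ} (e : ZVertex φ (boolSubformulas φ) ≃ Fin k)
    (he : ∀ s t, s.Anc t → e s ≤ e t) :
    (elSystem e (coloring (boolSubformulas φ)) G.cpre).solution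
      (e (ZVertex.root φ (boolSubformulas φ))) = G.winningRegion :=
  Set.Subset.antisymm (solution_subset_winningRegion hwin subset_rfl (boolSubformulas_finite φ) he _)
    (winningRegion_subset_solution hwin subset_rfl (boolSubformulas_finite φ) he _)
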